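/- Let $0<p<1$, let $n\ge 0$, and let $\mu$ be the $p$-biased measure on $\{-1,1\}^n$, i.e. the product measure in which each coordinate equals $1$ with probability $p$ and $-1$ with probability $1-p$. For $q\ge 1$ let $\|f\|_q=\left(\int |f|^q\,d\mu\right)^{1/q}$. For $S\subseteq\{1,\dots,n\}$ let $\chi_S(x)=\prod_{i\in S}\chi_i(x)$, where $\chi_i(x)=\sqrt{\frac{1-p}{p}}$ if $x_i=1$ and $\chi_i(x)=-\sqrt{\frac{p}{1-p}}$ if $x_i=-1$. For $f:\{-1,1\}^n\to\mathbb{R}$ let $\hat f(S)=\int f\chi_S\,d\mu$, and for $\gamma\in\mathbb{R}$ let $$T_\gamma f=\sum_{S\subseteq\{1,\dots,n\}}\gamma^{|S|}\hat f(S)\chi_S ,\qquad \gamma^0=1 .$$ Let $\lambda=\min\{p,1-p\}$, and let $\rho(q)$, for $q\ge 2$, be any one of the following three functions: 1. $\rho(q)=\lambda^{\frac12-\frac1q}$; 2. $\rho(q)=\sqrt{q-1}\,\sqrt{\dfrac{\sinh\left(-\frac1q\ln\frac{\lambda}{1-\lambda}\right)}{\sinh\left(-\left(1-\frac1q\right)\ln\frac{\lambda}{1-\lambda}\right)}}$,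 read as its limit $1$ when $\lambda=\frac12$; 3. $\rho(q)=\sqrt{\dfrac{\lambda}{1-\lambda}}$. Put $\rho_1(\delta)=\rho\left(\frac1{\delta^2}+1\right)$ for $0<\delta\le 1$; for $\delta=0$ the product $\rho_1(\delta)\delta$ is read as $0$. Then for every $f:\{-1,1\}^n\to\mathbb{R}$ and every $0\le\delta\le 1$, $$\left\|T_{\rho_1(\delta)\,\delta}f\right\|_2\le\|f\|_{1+\delta^2}.$$ -/

import Mathlib

/-- The cube `{-1,1}^n`; the two-point set `{-1,1}` is the unit group of `ℤ`. -/
abbrev Cube (n : ℕ) : Type := Fin n → ℤˣ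

noncomputable section

/-- The weights of the one-coordinate measure: `1` has weight `p`, `-1` has weight `1 - p`. -/
def bitWeight (p : ℝ) (b : ℤˣ) : ℝ := if b = 1 then p else 1 - p

/-- The `p`-biased (product) measure of the point `x`. -/
def biasedWeight (p : ℝ) {n : ℕ} (x : Cube n) : ℝ := ∏ i, bitWeight p (x i)

/-- The norm of `L^q` of the `p`-biased measure, `(∫ |f|^q dμ)^(1/q)`. -/
def biasedNorm (p : ℝ) {n : ℕ} (q : ℝ) (f : Cube n → ℝ) : ℝ :=
  (∑ x, |f x| ^ q * biasedWeight p x) ^ (1 / q)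

/-- The normalized coordinate `(b - E b) / σ`, explicitly. -/
def bitChar (p : ℝ) (b : ℤˣ) : ℝ :=
  if b = 1 then √((1 - p) / p) else -√(p / (1 - p))

/-- The orthonormal basis function `χ_S = ∏_{i ∈ S} χ_i`. -/
def biasedChar (p : ℝ) {n : ℕ} (S : Finset (Fin n)) (x : Cube n) : ℝ :=
  ∏ i ∈ S, bitChar p (x i)

/-- The Fourier coefficient `⟨f, χ_S⟩` with respect to the `p`-biased measure. -/
def biasedFourier (p : ℝ) {n : ℕ} (f : Cube n → ℝ) (S : Finset (Fin n)) : ℝ :=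
  ∑ x, f x * biasedChar p S x * biasedWeight p x

/-- The smoothing operator `T_γ f = ∑_S γ^|S| f̂(S) χ_S` (with `γ^0 = 1`, also for `γ = 0`). -/
def smoothing (p γ : ℝ) {n : ℕ} (f : Cube n → ℝ) : Cube n → ℝ :=
  fun x => ∑ S : Finset (Fin n), γ ^ S.card * biasedFourier p f S * biasedChar p S x

/-- `λ = min {p, 1 - p}`. -/
def minProb (p : ℝ) : ℝ := min p (1 - p)

/-- First smoothing parameter: `λ^(1/2 - 1/q)`. -/
def rhoPower (p q : ℝ) : ℝ := minProb p ^ (1 / 2 - 1 / q)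

/-- Second smoothing parameter:
`√(q-1) √(sinh(-(1/q) ln(λ/(1-λ))) / sinh(-(1-1/q) ln(λ/(1-λ))))`.
For `λ = 1/2` the quotient reads `0/0`, and the value is the limit as `λ → 1/2`, which is `1`. -/
def rhoSinh (p q : ℝ) : ℝ :=
  if p = 1 / 2 then 1
  else √(q - 1) *
    √(Real.sinh (-(1 / q) * Real.log (minProb p / (1 - minProb p))) /
      Real.sinh (-(1 - 1 / q) * Real.log (minProb p / (1 - minProb p))))

/-- Third smoothing parameter: `√(λ/(1-λ))`, independent of `q`. -/
def rhoRatio (p : ℝ) (_q : ℝ) : ℝ := √(minProb p / (1 - minProb p))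

/-- `ρ₁(δ) = ρ(1/δ² + 1)`. At `δ = 0` only the product `ρ₁(δ) * δ` is used, and it is `0` whatever
(finite) value `ρ₁(0)` has. -/
def rhoOne (ρ : ℝ → ℝ) (δ : ℝ) : ℝ := ρ (1 / δ ^ 2 + 1)

end

/-! ### Convexity in hyperbolic coordinates -/

section

open Real Set Filter Topology

/-! Minkowski's inequality tensorizes contractions from `L^s` to `L^2` for `1 ≤ s ≤ 2`
(`contraction_tensor`), so one coordinate suffices. There the claim reads: squared mean plus `γ²`
times variance is at most the squared `L^s` norm (`TwoPoint`).

Write `λ = e^{-h} / (2 cosh h)` with `h ≥ 0`, and the two positive values as `e^{a-w}`, `e^{a+w}`.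
The claim becomes a lower bound on `cosh (h + s w) ^ (2/s)`. With `θ = s/2`, `cosh (θ z) ^ (1/θ)` is
a convex function of `cosh z`; its tangent at `z = 2h/s` gives the bound when `γ² sinh (2h/s) ≤ sinh
(2h - 2h/s)`.

For `s = 1 + δ²` the conjugate exponent is `q = 1/δ² + 1`. When `h > 0`, the sinh parameter gives
equality in this condition; the other two are handled by Bernoulli's inequality (`exp_mul_sinh_le`).
-/

theorem sinh_mul_le_mul_sinh {a z : ℝ} (ha0 : 0 ≤ a) (ha1 : a ≤ 1) (hz : 0 ≤ z) :
    sinh (a * z) ≤ a * sinh z := by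
  have hd : ∀ x : ℝ, HasDerivAt (fun x => a * sinh x - sinh (a * x))
      (a * cosh x - cosh (a * x) * (a * 1)) x := fun x =>
    ((hasDerivAt_sinh x).const_mul a).sub (((hasDerivAt_id x).const_mul a).sinh)
  have hm : MonotoneOn (fun x => a * sinh x - sinh (a * x)) (Ici 0) := by
    refine monotoneOn_of_deriv_nonneg (convex_Ici 0)
      (fun x _ => (hd x).continuousAt.continuousWithinAt)
      (fun x _ => (hd x).differentiableAt.differentiableWithinAt) fun x hx => ?_
    rw [interior_Ici, mem_Ioi] at hx
    have h : cosh (a * x) ≤ cosh x := by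
      rw [cosh_le_cosh, abs_of_nonneg (by positivity), abs_of_pos hx]
      nlinarith
    rw [(hd x).deriv]
    nlinarith
  have := hm self_mem_Ici hz hz
  simpa using this

/-- The derivative of `cosh (θ z) ^ (1 / θ)` with respect to `cosh z`. -/
noncomputable def coshSlope (θ z : ℝ) : ℝ :=
  cosh (θ * z) ^ (1 / θ - 1) * sinh (θ * z) / sinh z

theorem hasDerivAt_cosh_rpow (θ m z : ℝ) :
    HasDerivAt (fun z => cosh (θ * z) ^ m)
      (sinh (θ * z) * θ * m * cosh (θ * z) ^ (m - 1)) z := by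
  have h : HasDerivAt (fun z : ℝ => cosh (θ * z)) (sinh (θ * z) * (θ * 1)) z :=
    ((hasDerivAt_id z).const_mul θ).cosh
  simpa using h.rpow_const (p := m) (Or.inl (cosh_pos _).ne')

theorem coshSlope_monotoneOn {θ : ℝ} (hθ : 1 / 2 ≤ θ) (hθ1 : θ ≤ 1) :
    MonotoneOn (coshSlope θ) (Ioi 0) := by
  have hθ0 : 0 < θ := by linarith
  have hd : ∀ x : ℝ, 0 < x → HasDerivAt (coshSlope θ)
      (((sinh (θ * x) * θ * (1 / θ - 1) * cosh (θ * x) ^ (1 / θ - 1 - 1) * sinh (θ * x) +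
        cosh (θ * x) ^ (1 / θ - 1) * (cosh (θ * x) * (θ * 1))) * sinh x -
        cosh (θ * x) ^ (1 / θ - 1) * sinh (θ * x) * cosh x) / sinh x ^ 2) x := fun x hx =>
    ((hasDerivAt_cosh_rpow θ _ x).mul (((hasDerivAt_id x).const_mul θ).sinh)).div
      (hasDerivAt_sinh x) (sinh_pos_iff.2 hx).ne'
  refine monotoneOn_of_deriv_nonneg (convex_Ioi 0)
      (fun x hx => (hd x hx).continuousAt.continuousWithinAt)
      (fun x hx => (hd x (interior_subset hx)).differentiableAt.differentiableWithinAt)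
      fun x hx => ?_
  have hx0 : 0 < x := interior_subset hx
  rw [(hd x hx0).deriv]
  have hC := cosh_pos (θ * x)
  have hpow : cosh (θ * x) ^ (1 / θ - 1) = cosh (θ * x) ^ (1 / θ - 1 - 1) * cosh (θ * x) := by
    rw [← rpow_add_one hC.ne']; ring_nf
  have hP : 0 < cosh (θ * x) ^ (1 / θ - 1 - 1) := rpow_pos_of_pos hC _
  have hm : θ * (1 / θ - 1) = 1 - θ := by field_simp
  -- Up to a positive factor, the numerator of the derivative is half the gap in this inequality; `θ
  -- ≥ 1/2` makes the multiplier nonnegative.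
  have key := sinh_mul_le_mul_sinh (a := 2 * θ - 1) (by linarith) (by linarith) hx0.le
  have hexp : sinh ((2 * θ - 1) * x) =
      2 * sinh (θ * x) * cosh (θ * x) * cosh x -
        (cosh (θ * x) ^ 2 + sinh (θ * x) ^ 2) * sinh x := by
    rw [show (2 * θ - 1) * x = 2 * (θ * x) - x by ring, sinh_sub, sinh_two_mul, cosh_two_mul]
  have hsq := cosh_sq (θ * x)
  refine div_nonneg ?_ (sq_nonneg _)
  rw [hpow]
  have : (sinh (θ * x) * θ * (1 / θ - 1) * cosh (θ * x) ^ (1 / θ - 1 - 1) * sinh (θ * x) +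
        cosh (θ * x) ^ (1 / θ - 1 - 1) * cosh (θ * x) * (cosh (θ * x) * (θ * 1))) * sinh x -
        cosh (θ * x) ^ (1 / θ - 1 - 1) * cosh (θ * x) * sinh (θ * x) * cosh x =
      cosh (θ * x) ^ (1 / θ - 1 - 1) * (((1 - θ) * sinh (θ * x) ^ 2 + θ * cosh (θ * x) ^ 2) * sinh x
        - cosh (θ * x) * sinh (θ * x) * cosh x) := by
    rw [← hm]; ring
  rw [this]
  refine mul_nonneg hP.le ?_
  rw [hexp] at key
  rw [hsq] at key ⊢
  nlinarith

theorem exists_coshSlope_eq {θ a b : ℝ} (hθ : 0 < θ) (ha : 0 ≤ a) (hab : a < b) :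
    ∃ c ∈ Ioo a b, cosh (θ * b) ^ (1 / θ) - cosh (θ * a) ^ (1 / θ) =
      coshSlope θ c * (cosh b - cosh a) := by
  obtain ⟨c, hc, h⟩ := exists_ratio_hasDerivAt_eq_ratio_slope
    (fun z => cosh (θ * z) ^ (1 / θ)) _ hab
    (fun x _ => (hasDerivAt_cosh_rpow θ (1 / θ) x).continuousAt.continuousWithinAt)
    (fun x _ => hasDerivAt_cosh_rpow θ (1 / θ) x) cosh sinh
    continuous_cosh.continuousOn (fun x _ => hasDerivAt_cosh x)
  refine ⟨c, hc, ?_⟩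
  have hs : 0 < sinh c := sinh_pos_iff.2 (ha.trans_lt hc.1)
  rw [coshSlope, div_mul_eq_mul_div, eq_div_iff hs.ne', ← h]
  field_simp

/-- `cosh (θ z) ^ (1 / θ)` is a convex function of `cosh z`: the tangent line bound. -/
theorem cosh_rpow_ge_tangent {θ z₀ : ℝ} (hθ : 1 / 2 ≤ θ) (hθ1 : θ ≤ 1) (hz₀ : 0 < z₀) (z : ℝ) :
    cosh (θ * z₀) ^ (1 / θ) + coshSlope θ z₀ * (cosh z - cosh z₀) ≤ cosh (θ * z) ^ (1 / θ) := by
  have hθ0 : 0 < θ := by linarith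
  wlog hz : 0 ≤ z generalizing z
  · have := this (-z) (by linarith)
    rwa [mul_neg, cosh_neg, cosh_neg] at this
  have hmono := coshSlope_monotoneOn hθ hθ1
  rcases lt_trichotomy z z₀ with h | rfl | h
  · obtain ⟨c, hc, e⟩ := exists_coshSlope_eq hθ0 hz h
    have h1 := hmono (hz.trans_lt hc.1) hz₀ hc.2.le
    have h2 : cosh z ≤ cosh z₀ := by
      rw [cosh_le_cosh, abs_of_nonneg hz, abs_of_pos hz₀]; exact h.le
    nlinarith
  · simp
  · obtain ⟨c, hc, e⟩ := exists_coshSlope_eq hθ0 hz₀.le h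
    have h1 := hmono hz₀ (hz₀.trans hc.1) hc.1.le
    have h2 : cosh z₀ ≤ cosh z := by
      rw [cosh_le_cosh, abs_of_nonneg hz, abs_of_pos hz₀]; exact h.le
    nlinarith

theorem tendsto_coshSlope_zero (θ : ℝ) : Tendsto (coshSlope θ) (𝓝[>] 0) (𝓝 θ) := by
  have h1 : Tendsto (fun z : ℝ => sinh (θ * z) / z) (𝓝[>] 0) (𝓝 θ) := by
    have : HasDerivAt (fun z : ℝ => sinh (θ * z)) (cosh (θ * 0) * (θ * 1)) 0 :=
      ((hasDerivAt_id (0 : ℝ)).const_mul θ).sinh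
    have h := this.tendsto_slope_zero_right
    simpa [div_eq_inv_mul] using h
  have h2 : Tendsto (fun z : ℝ => sinh z / z) (𝓝[>] 0) (𝓝 1) := by
    have h := (hasDerivAt_sinh (0 : ℝ)).tendsto_slope_zero_right
    simpa [div_eq_inv_mul] using h
  have h3 : Tendsto (fun z : ℝ => cosh (θ * z) ^ (1 / θ - 1)) (𝓝[>] 0) (𝓝 1) := by
    have h := (hasDerivAt_cosh_rpow θ (1 / θ - 1) 0).continuousAt.tendsto
    simp only [mul_zero, cosh_zero, one_rpow] at h
    exact h.mono_left nhdsWithin_le_nhds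
  have h4 := h3.mul (h1.div h2 one_ne_zero)
  rw [div_one, one_mul] at h4
  refine h4.congr' ?_
  filter_upwards [self_mem_nhdsWithin] with z hz
  have hz : 0 < z := hz
  simp only [coshSlope, Pi.div_apply]
  have := (sinh_pos_iff.2 hz).ne'
  field_simp

/-- Limit of the tangent bound as `z₀ → 0`, where `coshSlope` is a quotient `0/0`; it serves the
unbiased case `h = 0`. -/
theorem one_add_le_cosh_rpow {θ : ℝ} (hθ : 1 / 2 ≤ θ) (hθ1 : θ ≤ 1) (z : ℝ) :
    1 + θ * (cosh z - 1) ≤ cosh (θ * z) ^ (1 / θ) := by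
  have h1 : Tendsto (fun z₀ : ℝ => cosh (θ * z₀) ^ (1 / θ)) (𝓝[>] 0) (𝓝 1) := by
    have h := (hasDerivAt_cosh_rpow θ (1 / θ) 0).continuousAt.tendsto
    simp only [mul_zero, cosh_zero, one_rpow] at h
    exact h.mono_left nhdsWithin_le_nhds
  have h2 : Tendsto (fun z₀ : ℝ => cosh z₀) (𝓝[>] 0) (𝓝 1) := by
    have h := (continuous_cosh.tendsto 0)
    rw [cosh_zero] at h
    exact h.mono_left nhdsWithin_le_nhds
  refine le_of_tendsto (h1.add ((tendsto_coshSlope_zero θ).mul (h2.const_sub (cosh z)))) ?_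
  filter_upwards [self_mem_nhdsWithin] with z₀ hz₀
  exact cosh_rpow_ge_tangent hθ hθ1 hz₀ z

/-! ### The two-point inequality -/

/-- The tangent point `2h/s` corresponds to `w = 0`, the constant functions, where equality holds.
At `h = 0` the condition `hg` is vacuous, so `hg0` supplies its limiting form. -/
theorem cosh_sq_add_mul_sinh_sq_le {s h g : ℝ} (hs1 : 1 ≤ s) (hs2 : s ≤ 2) (hh : 0 ≤ h)
    (hg : g * sinh (2 * h / s) ≤ sinh (2 * h - 2 * h / s)) (hg0 : h = 0 → g ≤ s - 1) (w : ℝ) :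
    cosh (h + w) ^ 2 + g * sinh w ^ 2 ≤ cosh h ^ 2 * (cosh (h + s * w) / cosh h) ^ (2 / s) := by
  have hs : 0 < s := by linarith
  have hC := cosh_pos h
  have hθ : 1 / (s / 2) = 2 / s := by field_simp
  rcases hh.eq_or_lt with rfl | hh
  · have h1 := one_add_le_cosh_rpow (θ := s / 2) (by linarith) (by linarith) (2 * w)
    have h2 := hg0 rfl
    rw [hθ, show s / 2 * (2 * w) = s * w by ring, cosh_two_mul] at h1
    have h3 := cosh_sq w
    simp only [zero_add, cosh_zero, one_pow, one_mul, div_one]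
    nlinarith [sq_nonneg (sinh w)]
  · have hz₀ : 0 < 2 * h / s := by positivity
    have h1 := cosh_rpow_ge_tangent (θ := s / 2) (by linarith) (by linarith) hz₀ (2 * w + 2 * h / s)
    have hS := sinh_pos_iff.2 hz₀
    have e1 : s / 2 * (2 * h / s) = h := by field_simp
    have e2 : s / 2 * (2 * w + 2 * h / s) = h + s * w := by field_simp; ring
    rw [coshSlope, hθ, e1, e2, rpow_sub_one hC.ne'] at h1
    have hP : 0 < cosh h ^ (2 / s) := rpow_pos_of_pos hC _
    rw [div_rpow (cosh_pos _).le hC.le, mul_div_assoc', le_div_iff₀ hP]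
    refine le_trans ?_ (mul_le_mul_of_nonneg_left h1 (sq_nonneg (cosh h)))
    set z := 2 * h / s
    -- With `g * sinh z` replaced by `sinh (2 * h - z)` this is an identity.
    have key : cosh (h + w) ^ 2 * sinh z + g * sinh z * sinh w ^ 2 ≤
        cosh h ^ 2 * sinh z + cosh h * sinh h * (cosh (2 * w + z) - cosh z) := by
      have := mul_le_mul_of_nonneg_right hg (sq_nonneg (sinh w))
      refine (add_le_add_right this _).trans (le_of_eq ?_)
      rw [sinh_sub, cosh_add, cosh_add, sinh_two_mul, cosh_two_mul, cosh_two_mul, sinh_two_mul]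
      have a1 := cosh_sq h
      have a2 := cosh_sq w
      have a3 : cosh h ^ 4 = (sinh h ^ 2 + 1) ^ 2 := by rw [← a1]; ring
      ring_nf
      simp only [a1, a2]
      ring
    have e3 : cosh h ^ 2 * (cosh h ^ (2 / s) + cosh h ^ (2 / s) / cosh h * sinh h / sinh z *
        (cosh (2 * w + z) - cosh z)) = cosh h ^ (2 / s) / sinh z *
        (cosh h ^ 2 * sinh z + cosh h * sinh h * (cosh (2 * w + z) - cosh z)) := by
      field_simp
    have e4 : (cosh (h + w) ^ 2 + g * sinh w ^ 2) * cosh h ^ (2 / s) = cosh h ^ (2 / s) / sinh z *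
        (cosh (h + w) ^ 2 * sinh z + g * sinh z * sinh w ^ 2) := by
      field_simp
    rw [e3, e4]
    exact mul_le_mul_of_nonneg_left key (by positivity)

/-- The hypercontractive two-point inequality with parameters `p`, `s` and `g = γ²`. -/
def TwoPoint (p s g : ℝ) : Prop :=
  ∀ x y : ℝ, (p * x + (1 - p) * y) ^ 2 + g * (p * (1 - p)) * (x - y) ^ 2 ≤
    (p * |x| ^ s + (1 - p) * |y| ^ s) ^ (2 / s)

theorem TwoPoint.symm {p s g : ℝ} (h : TwoPoint p s g) : TwoPoint (1 - p) s g := fun x y => by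
  have := h y x
  rw [sub_sub_cancel]
  convert this using 1
  · ring
  · ring_nf

theorem twoPoint_pos {s h g : ℝ} (hs1 : 1 ≤ s) (hs2 : s ≤ 2) (hh : 0 ≤ h)
    (hg : g * sinh (2 * h / s) ≤ sinh (2 * h - 2 * h / s)) (hg0 : h = 0 → g ≤ s - 1)
    {p : ℝ} (hp : p = exp (-h) / (2 * cosh h)) {x y : ℝ} (hx : 0 < x) (hy : 0 < y) :
    (p * x + (1 - p) * y) ^ 2 + g * (p * (1 - p)) * (x - y) ^ 2 ≤
      (p * x ^ s + (1 - p) * y ^ s) ^ (2 / s) := by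
  have hs : 0 < s := by linarith
  have hC := cosh_pos h
  have hq : 1 - p = exp h / (2 * cosh h) := by
    rw [hp, eq_div_iff (by positivity), sub_mul, div_mul_cancel₀ _ (by positivity), cosh_eq]; ring
  obtain ⟨a, w, rfl, rfl⟩ : ∃ a w, x = exp (a - w) ∧ y = exp (a + w) := by
    refine ⟨(log x + log y) / 2, (log y - log x) / 2, ?_, ?_⟩
    · rw [show (log x + log y) / 2 - (log y - log x) / 2 = log x by ring, exp_log hx]
    · rw [show (log x + log y) / 2 + (log y - log x) / 2 = log y by ring, exp_log hy]
  have e1 : p * exp (a - w) + (1 - p) * exp (a + w) = exp a * (cosh (h + w) / cosh h) := by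
    rw [hq, hp, cosh_eq (h + w), neg_add, sub_eq_add_neg, exp_add, exp_add, exp_add, exp_add]
    field_simp
    ring
  have e2 : p * exp (a - w) ^ s + (1 - p) * exp (a + w) ^ s =
      exp a ^ s * (cosh (h + s * w) / cosh h) := by
    rw [hq, hp, cosh_eq (h + s * w), neg_add, ← exp_mul, ← exp_mul, ← exp_mul,
      show (a - w) * s = a * s + -(s * w) by ring, show (a + w) * s = a * s + s * w by ring,
      exp_add, exp_add, exp_add, exp_add]
    field_simp
    ring
  have e3 : g * (p * (1 - p)) * (exp (a - w) - exp (a + w)) ^ 2 =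
      exp a ^ 2 * (g * sinh w ^ 2 / cosh h ^ 2) := by
    rw [hq, hp, sinh_eq, sub_eq_add_neg a w, exp_add, exp_add,
      show exp (-h) / (2 * cosh h) * (exp h / (2 * cosh h)) = 1 / (4 * cosh h ^ 2) by
        rw [div_mul_div_comm, ← exp_add, neg_add_cancel, exp_zero]; ring]
    field_simp
    ring
  have key := cosh_sq_add_mul_sinh_sq_le hs1 hs2 hh hg hg0 w
  rw [e1, e2, e3, mul_rpow (by positivity) (by have := cosh_pos (h + s * w); positivity),
    ← rpow_mul (exp_pos a).le, mul_div_cancel₀ _ hs.ne', rpow_two]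
  rw [show (exp a * (cosh (h + w) / cosh h)) ^ 2 + exp a ^ 2 * (g * sinh w ^ 2 / cosh h ^ 2) =
    exp a ^ 2 * ((cosh (h + w) ^ 2 + g * sinh w ^ 2) / cosh h ^ 2) by ring]
  refine mul_le_mul_of_nonneg_left ?_ (sq_nonneg _)
  rw [div_le_iff₀ (by positivity), mul_comm _ (cosh h ^ 2)]
  exact key

theorem twoPoint_of_sinh_le {s h g : ℝ} (hs1 : 1 ≤ s) (hs2 : s ≤ 2) (hh : 0 ≤ h)
    (hg : g * sinh (2 * h / s) ≤ sinh (2 * h - 2 * h / s)) (hg0 : h = 0 → g ≤ s - 1)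
    {p : ℝ} (hp : p = exp (-h) / (2 * cosh h)) : TwoPoint p s g := by
  have hs : 0 < s := by linarith
  have hC := cosh_pos h
  have hq : 1 - p = exp h / (2 * cosh h) := by
    rw [hp, eq_div_iff (by positivity), sub_mul, div_mul_cancel₀ _ (by positivity), cosh_eq]; ring
  have hp0 : 0 < p := by rw [hp]; positivity
  have hq0 : 0 < 1 - p := by rw [hq]; positivity
  -- Needed for signs: the coefficient of `x * y` is `2p(1-p)(1-g)`, so passing to absolute values
  -- can only increase the left side.
  have hg1 : g ≤ 1 := by
    rcases hh.eq_or_lt with rfl | hh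
    · linarith [hg0 rfl]
    · have h1 : sinh (2 * h - 2 * h / s) ≤ sinh (2 * h / s) := by
        rw [sinh_le_sinh, sub_le_iff_le_add, ← add_div, le_div_iff₀ hs]
        nlinarith
      have h2 : 0 < sinh (2 * h / s) := sinh_pos_iff.2 (by positivity)
      nlinarith
  have hnn : ∀ x y : ℝ, 0 ≤ x → 0 ≤ y →
      (p * x + (1 - p) * y) ^ 2 + g * (p * (1 - p)) * (x - y) ^ 2 ≤
        (p * x ^ s + (1 - p) * y ^ s) ^ (2 / s) := by
    intro x y hx hy
    -- Zero values are reached by shifting both arguments by `e > 0` and letting `e → 0`.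
    have hL : Continuous fun e : ℝ => (p * (x + e) + (1 - p) * (y + e)) ^ 2 +
        g * (p * (1 - p)) * ((x + e) - (y + e)) ^ 2 := by fun_prop
    have hR : Continuous fun e : ℝ => (p * (x + e) ^ s + (1 - p) * (y + e) ^ s) ^ (2 / s) := by
      have h1 : ∀ t : ℝ, Continuous fun e : ℝ => (t + e) ^ s := fun t =>
        (continuous_const.add continuous_id).rpow_const fun _ => Or.inr hs.le
      exact ((continuous_const.mul (h1 x)).add (continuous_const.mul (h1 y))).rpow_const
        fun _ => Or.inr (by positivity)
    have := le_of_tendsto_of_tendsto ((hL.tendsto 0).mono_left nhdsWithin_le_nhds)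
      ((hR.tendsto 0).mono_left nhdsWithin_le_nhds) (b := 𝓝[>] 0) (by
        filter_upwards [self_mem_nhdsWithin] with e he
        have he : 0 < e := he
        exact twoPoint_pos hs1 hs2 hh hg hg0 hp (by positivity) (by positivity))
    simpa only [add_zero] using this
  intro x y
  refine le_trans ?_ (hnn |x| |y| (abs_nonneg x) (abs_nonneg y))
  have hxy : x * y ≤ |x| * |y| := by rw [← abs_mul]; exact le_abs_self _
  have hc : 0 ≤ p * (1 - p) * (1 - g) := by
    have := sub_nonneg.2 hg1
    positivity
  have := mul_le_mul_of_nonneg_left hxy hc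
  have h1 := sq_abs x
  have h2 := sq_abs y
  have expand : ∀ x y : ℝ, (p * x + (1 - p) * y) ^ 2 + g * (p * (1 - p)) * (x - y) ^ 2 =
      (p ^ 2 + g * (p * (1 - p))) * x ^ 2 + ((1 - p) ^ 2 + g * (p * (1 - p))) * y ^ 2 +
      2 * (p * (1 - p) * (1 - g) * (x * y)) := fun x y => by ring
  rw [expand, expand, h1, h2]
  linarith

end

/-! ### Tensorization -/

open Real

/-- Minkowski's inequality for a finite sum of nonnegative functions. -/
theorem Lp_sum_le_of_nonneg {ι κ : Type*} (t : Finset κ) (s : Finset ι) (f : κ → ι → ℝ) {r : ℝ}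
    (hr : 1 ≤ r) (hf : ∀ k i, 0 ≤ f k i) :
    (∑ i ∈ s, (∑ k ∈ t, f k i) ^ r) ^ (1 / r) ≤ ∑ k ∈ t, (∑ i ∈ s, f k i ^ r) ^ (1 / r) := by
  classical
  have hr0 : r ≠ 0 := by linarith
  induction t using Finset.induction_on with
  | empty => simp [zero_rpow hr0, zero_rpow (inv_ne_zero hr0)]
  | insert a t ha ih =>
    simp only [Finset.sum_insert ha]
    exact (Lp_add_le_of_nonneg s hr (fun i _ => hf a i)
      fun i _ => Finset.sum_nonneg fun k _ => hf k i).trans (add_le_add_right ih _)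

theorem sum_cons_pi {α : Type*} [Fintype α] {n : ℕ} (F : (Fin (n + 1) → α) → ℝ) :
    ∑ x, F x = ∑ a, ∑ x : Fin n → α, F (Fin.cons a x : Fin (n + 1) → α) := by
  rw [← (Fin.consEquiv fun _ => α).sum_comp, Fintype.sum_prod_type]
  rfl

/-- Minkowski's inequality with a weight `W`, exchanging an `L^s` and an `L^2` norm. -/
theorem sum_weight_mul_rpow_sum_le {α β : Type*} [Fintype α] [Fintype β] {w : α → ℝ} {W : β → ℝ}
    (hw : ∀ a, 0 ≤ w a) (hW : ∀ x, 0 ≤ W x) {s : ℝ} (hs1 : 1 ≤ s) (hs2 : s ≤ 2)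
    (g : α → β → ℝ) :
    ∑ x, W x * (∑ a, w a * |g a x| ^ s) ^ (2 / s) ≤
      (∑ a, w a * (∑ x, W x * g a x ^ 2) ^ (s / 2)) ^ (2 / s) := by
  have hs : 0 < s := by linarith
  have hr : 1 ≤ 2 / s := by rwa [le_div_iff₀ hs, one_mul]
  have hinv : 1 / (2 / s) = s / 2 := by field_simp
  have hss : s / 2 * (2 / s) = 1 := by field_simp
  have hsum : ∀ x, 0 ≤ ∑ a, w a * |g a x| ^ s := fun x =>
    Finset.sum_nonneg fun a _ => mul_nonneg (hw a) (by positivity)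
  -- The weight enters as `W ^ (s / 2)`, so that the outer power `2 / s` restores `W`.
  have key := Lp_sum_le_of_nonneg Finset.univ Finset.univ
    (fun a x => W x ^ (s / 2) * (w a * |g a x| ^ s)) hr
    (fun a x => mul_nonneg (rpow_nonneg (hW x) _) (mul_nonneg (hw a) (by positivity)))
  rw [hinv] at key
  have hl : ∀ x, (∑ a, W x ^ (s / 2) * (w a * |g a x| ^ s)) ^ (2 / s) =
      W x * (∑ a, w a * |g a x| ^ s) ^ (2 / s) := fun x => by
    rw [← Finset.mul_sum, mul_rpow (rpow_nonneg (hW x) _) (hsum x), ← rpow_mul (hW x), hss,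
      rpow_one]
  have hrr : ∀ a, (∑ x, (W x ^ (s / 2) * (w a * |g a x| ^ s)) ^ (2 / s)) ^ (s / 2) =
      w a * (∑ x, W x * g a x ^ 2) ^ (s / 2) := fun a => by
    have : ∀ x, (W x ^ (s / 2) * (w a * |g a x| ^ s)) ^ (2 / s) =
        w a ^ (2 / s) * (W x * g a x ^ 2) := fun x => by
      rw [mul_rpow (rpow_nonneg (hW x) _) (mul_nonneg (hw a) (by positivity)),
        mul_rpow (hw a) (by positivity), ← rpow_mul (hW x), hss, rpow_one,
        ← rpow_mul (abs_nonneg _), mul_div_cancel₀ _ hs.ne', rpow_two, sq_abs]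
      ring
    simp only [this]
    rw [← Finset.mul_sum, mul_rpow (rpow_nonneg (hw a) _)
      (Finset.sum_nonneg fun x _ => mul_nonneg (hW x) (sq_nonneg _)), ← rpow_mul (hw a),
      mul_comm (2 / s), hss, rpow_one]
  simp only [hl, hrr] at key
  have h0 : 0 ≤ ∑ x, W x * (∑ a, w a * |g a x| ^ s) ^ (2 / s) :=
    Finset.sum_nonneg fun x _ => mul_nonneg (hW x) (rpow_nonneg (hsum x) _)
  have := rpow_le_rpow (rpow_nonneg h0 _) key (z := 2 / s) (by positivity)
  rwa [← rpow_mul h0, hss, rpow_one] at this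

/-- A contraction from `L^s` to `L^2` (`1 ≤ s ≤ 2`) tensorizes. -/
theorem contraction_tensor {α : Type*} [Fintype α] {w : α → ℝ} (hw : ∀ a, 0 ≤ w a)
    (k : α → α → ℝ) {s : ℝ} (hs1 : 1 ≤ s) (hs2 : s ≤ 2)
    (h : ∀ g : α → ℝ, ∑ a, w a * (∑ b, k a b * g b) ^ 2 ≤ (∑ a, w a * |g a| ^ s) ^ (2 / s))
    (n : ℕ) (f : (Fin n → α) → ℝ) :
    ∑ x : Fin n → α, (∏ i, w (x i)) * (∑ y : Fin n → α, (∏ i, k (x i) (y i)) * f y) ^ 2 ≤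
      (∑ x : Fin n → α, (∏ i, w (x i)) * |f x| ^ s) ^ (2 / s) := by
  have hs : 0 < s := by linarith
  have hss : 2 / s * (s / 2) = 1 := by field_simp
  induction n with
  | zero =>
    simp only [Finset.univ_eq_empty, Finset.prod_empty, one_mul, Finset.univ_unique,
      Finset.sum_singleton]
    rw [← rpow_mul (abs_nonneg _), mul_div_cancel₀ _ hs.ne', rpow_two, sq_abs]
  | succ n ih =>
    have hW : ∀ x : Fin n → α, 0 ≤ ∏ i, w (x i) := fun x => Finset.prod_nonneg fun i _ => hw _
    let g : α → (Fin n → α) → ℝ := fun b x =>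
      ∑ y : Fin n → α, (∏ i, k (x i) (y i)) * f (Fin.cons b y : Fin (n + 1) → α)
    have e1 : ∑ x : Fin (n + 1) → α, (∏ i, w (x i)) * (∑ y, (∏ i, k (x i) (y i)) * f y) ^ 2 =
        ∑ x : Fin n → α, (∏ i, w (x i)) * ∑ a, w a * (∑ b, k a b * g b x) ^ 2 := by
      rw [sum_cons_pi, Finset.sum_comm]
      refine Finset.sum_congr rfl fun x _ => ?_
      rw [Finset.mul_sum]
      refine Finset.sum_congr rfl fun a _ => ?_
      have : ∑ y : Fin (n + 1) → α, (∏ i, k ((Fin.cons a x : Fin (n + 1) → α) i) (y i)) * f y =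
          ∑ b, k a b * g b x := by
        rw [sum_cons_pi]
        refine Finset.sum_congr rfl fun b _ => ?_
        simp only [g, Finset.mul_sum, Fin.prod_univ_succ, Fin.cons_zero, Fin.cons_succ, mul_assoc]
      rw [this, Fin.prod_univ_succ]
      simp only [Fin.cons_zero, Fin.cons_succ]
      ring
    have e2 : ∑ x : Fin (n + 1) → α, (∏ i, w (x i)) * |f x| ^ s =
        ∑ a, w a * ∑ x : Fin n → α, (∏ i, w (x i)) * |f (Fin.cons a x : Fin (n + 1) → α)| ^ s := by
      rw [sum_cons_pi]
      refine Finset.sum_congr rfl fun a _ => ?_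
      simp only [Finset.mul_sum, Fin.prod_univ_succ, Fin.cons_zero, Fin.cons_succ, mul_assoc]
    rw [e1, e2]
    -- Contract in the first coordinate, exchange the norms, then contract each section by
    -- induction.
    calc _ ≤ ∑ x : Fin n → α, (∏ i, w (x i)) * (∑ a, w a * |g a x| ^ s) ^ (2 / s) :=
          Finset.sum_le_sum fun x _ => mul_le_mul_of_nonneg_left (h fun b => g b x) (hW x)
      _ ≤ (∑ a, w a * (∑ x : Fin n → α, (∏ i, w (x i)) * g a x ^ 2) ^ (s / 2)) ^ (2 / s) :=
          sum_weight_mul_rpow_sum_le hw hW hs1 hs2 g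
      _ ≤ _ := by
          have hq : ∀ a, 0 ≤ ∑ x : Fin n → α, (∏ i, w (x i)) * g a x ^ 2 := fun a =>
            Finset.sum_nonneg fun x _ => mul_nonneg (hW x) (sq_nonneg _)
          refine rpow_le_rpow (Finset.sum_nonneg fun a _ =>
            mul_nonneg (hw a) (rpow_nonneg (hq a) _)) ?_ (by positivity)
          refine Finset.sum_le_sum fun a _ => mul_le_mul_of_nonneg_left ?_ (hw a)
          have := rpow_le_rpow (hq a) (ih fun y => f (Fin.cons a y : Fin (n + 1) → α))
            (z := s / 2) (by positivity)
          rwa [← rpow_mul (Finset.sum_nonneg fun x _ => mul_nonneg (hW x) (by positivity)), hss,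
            rpow_one] at this

/-! ### The smoothing operator as a product kernel -/

theorem sum_intUnits (F : ℤˣ → ℝ) : ∑ b, F b = F 1 + F (-1) := by
  rw [UnitsInt.univ, Finset.sum_pair (by decide)]

/-- Expanding `∏ (1 + γ χ_i(x) χ_i(y))` over subsets gives `∑ γ^|S| χ_S(x) χ_S(y)`. -/
theorem smoothing_eq_sum_kernel (p γ : ℝ) {n : ℕ} (f : Cube n → ℝ) (x : Cube n) :
    smoothing p γ f x =
      ∑ y, (∏ i, (1 + γ * bitChar p (x i) * bitChar p (y i)) * bitWeight p (y i)) * f y := by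
  have h : ∀ y : Cube n, ∏ i, (1 + γ * bitChar p (x i) * bitChar p (y i)) =
      ∑ S : Finset (Fin n), γ ^ S.card * biasedChar p S x * biasedChar p S y := fun y => by
    rw [Finset.prod_one_add, Finset.powerset_univ]
    refine Finset.sum_congr rfl fun S _ => ?_
    rw [Finset.prod_mul_distrib, Finset.prod_mul_distrib, Finset.prod_const]
    rfl
  simp only [Finset.prod_mul_distrib, h, smoothing, biasedFourier, Finset.mul_sum, Finset.sum_mul]
  rw [Finset.sum_comm]
  refine Finset.sum_congr rfl fun y _ => Finset.sum_congr rfl fun S _ => ?_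
  rw [biasedWeight]
  ring

/-- Parseval on one coordinate: the mean is kept and the variance `p(1-p)(g 1 - g (-1))²` is scaled
by `γ²`. -/
theorem sum_bitWeight_mul_kernel_sq {p : ℝ} (hp0 : 0 < p) (hp1 : p < 1) (γ : ℝ) (g : ℤˣ → ℝ) :
    ∑ a, bitWeight p a *
        (∑ b, (1 + γ * bitChar p a * bitChar p b) * bitWeight p b * g b) ^ 2 =
      (p * g 1 + (1 - p) * g (-1)) ^ 2 + γ ^ 2 * (p * (1 - p)) * (g 1 - g (-1)) ^ 2 := by
  have hq : 0 < 1 - p := by linarith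
  have hne : (-1 : ℤˣ) ≠ 1 := by decide
  simp only [sum_intUnits, bitWeight, bitChar, hne, if_true, if_false]
  have hB : √(p / (1 - p)) = (√((1 - p) / p))⁻¹ := by rw [← sqrt_inv, inv_div]
  have hA0 : 0 < √((1 - p) / p) := by positivity
  have hA : √((1 - p) / p) ^ 2 = (1 - p) / p := sq_sqrt (by positivity)
  rw [hB]
  set A := √((1 - p) / p)
  have h1 : p * A ^ 2 = 1 - p := by rw [hA]; field_simp
  have h2 : (1 - p) * A⁻¹ = p * A := by rw [← h1]; field_simp
  have h3 : (1 - p) * A⁻¹ ^ 2 = p := by rw [← h1]; field_simp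
  have h4 : A * A⁻¹ = 1 := mul_inv_cancel₀ hA0.ne'
  have i1 : (1 + γ * A * A) * p * g 1 + (1 + γ * A * -A⁻¹) * (1 - p) * g (-1) =
      (p * g 1 + (1 - p) * g (-1)) + γ * A * (p * A) * (g 1 - g (-1)) := by
    linear_combination (-γ * A * g (-1)) * h2
  have i2 : (1 + γ * -A⁻¹ * A) * p * g 1 + (1 + γ * -A⁻¹ * -A⁻¹) * (1 - p) * g (-1) =
      (p * g 1 + (1 - p) * g (-1)) - γ * A⁻¹ * (p * A) * (g 1 - g (-1)) := by
    linear_combination (γ * A⁻¹ * g (-1)) * h2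
  rw [i1, i2]
  have h5 : (p * A) ^ 2 = p * (1 - p) := by rw [← h1]; ring
  linear_combination (γ ^ 2 * (g 1 - g (-1)) ^ 2) * h5 +
    (γ ^ 2 * (p * A) ^ 2 * (g 1 - g (-1)) ^ 2) * (h1 + h3) -
    (2 * (p * g 1 + (1 - p) * g (-1)) * γ * (p * A) * (g 1 - g (-1))) * h2

theorem biasedNorm_smoothing_le {p : ℝ} (hp0 : 0 < p) (hp1 : p < 1) {s γ : ℝ} (hs1 : 1 ≤ s)
    (hs2 : s ≤ 2) (h : TwoPoint p s (γ ^ 2)) {n : ℕ} (f : Cube n → ℝ) :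
    biasedNorm p 2 (smoothing p γ f) ≤ biasedNorm p s f := by
  have hw : ∀ a, 0 ≤ bitWeight p a := fun a => by
    unfold bitWeight; split_ifs <;> linarith
  have hs : 0 < s := by linarith
  have key := contraction_tensor hw
    (fun a b => (1 + γ * bitChar p a * bitChar p b) * bitWeight p b) hs1 hs2 (fun g => by
      rw [sum_bitWeight_mul_kernel_sq hp0 hp1, sum_intUnits]
      have hne : (-1 : ℤˣ) ≠ 1 := by decide
      simpa only [bitWeight, hne, if_true, if_false] using h (g 1) (g (-1))) n f
  have hnn : ∀ x : Cube n, 0 ≤ ∏ i, bitWeight p (x i) := fun x =>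
    Finset.prod_nonneg fun i _ => hw _
  simp only [← smoothing_eq_sum_kernel] at key
  have := rpow_le_rpow (Finset.sum_nonneg fun x _ => mul_nonneg (hnn x) (sq_nonneg _)) key
    (z := 1 / 2) (by norm_num)
  rw [← rpow_mul (Finset.sum_nonneg fun x _ => mul_nonneg (hnn x) (by positivity)),
    show 2 / s * (1 / 2) = 1 / s by field_simp] at this
  simpa only [biasedNorm, biasedWeight, rpow_two, sq_abs, mul_comm] using this

/-! ### The three smoothing parameters -/

/-- With `h = q k` this is Bernoulli's inequality `1 - (q-1)(1 - u) ≤ u^(q-1)` at `u = e^{-4k}`. -/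
theorem exp_mul_sinh_le {q h : ℝ} (hq : 2 ≤ q) (hh : 0 ≤ h) :
    exp (-(2 * h)) ^ (1 - 2 / q) * sinh ((1 - 1 / q) * (2 * h)) ≤
      (q - 1) * sinh (1 / q * (2 * h)) := by
  have hq0 : 0 < q := by linarith
  obtain ⟨k, rfl⟩ : ∃ k, h = q * k := ⟨h / q, by field_simp⟩
  have hk : 0 ≤ k := nonneg_of_mul_nonneg_right hh hq0
  have e1 : -(2 * (q * k)) * (1 - 2 / q) = 4 * k - 2 * (q * k) := by field_simp; ring
  have e2 : (1 - 1 / q) * (2 * (q * k)) = 2 * (q * k) - 2 * k := by field_simp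
  have e3 : 1 / q * (2 * (q * k)) = 2 * k := by field_simp
  rw [← exp_mul, e1, e2, e3, sinh_eq, sinh_eq]
  have hb := one_add_mul_self_le_rpow_one_add (s := exp (-(4 * k)) - 1) (p := q - 1)
    (by linarith [exp_pos (-(4 * k))]) (by linarith)
  rw [add_sub_cancel, ← exp_mul] at hb
  have f1 : exp (4 * k - 2 * (q * k)) * exp (2 * (q * k) - 2 * k) = exp (2 * k) := by
    rw [← exp_add]; ring_nf
  have f2 : exp (4 * k - 2 * (q * k)) * exp (-(2 * (q * k) - 2 * k)) =
      exp (2 * k) * exp (-(4 * k) * (q - 1)) := by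
    rw [← exp_add, ← exp_add]; ring_nf
  have f3 : exp (-(2 * k)) = exp (2 * k) * exp (-(4 * k)) := by
    rw [← exp_add]; ring_nf
  have := mul_le_mul_of_nonneg_left hb (exp_pos (2 * k)).le
  rw [f3, mul_div_assoc', mul_sub, f1, f2]
  linarith

theorem corollary3 (p : ℝ) (hp0 : 0 < p) (hp1 : p < 1) (ρ : ℝ → ℝ)
    (hρ : ρ = rhoPower p ∨ ρ = rhoSinh p ∨ ρ = rhoRatio p)
    (n : ℕ) (f : Cube n → ℝ) (δ : ℝ) (hδ0 : 0 ≤ δ) (hδ1 : δ ≤ 1) :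
    biasedNorm p 2 (smoothing p (rhoOne ρ δ * δ) f) ≤ biasedNorm p (1 + δ ^ 2) f := by
  have hs1 : 1 ≤ 1 + δ ^ 2 := by nlinarith
  have hs2 : 1 + δ ^ 2 ≤ 2 := by nlinarith
  refine biasedNorm_smoothing_le hp0 hp1 hs1 hs2 ?_ f
  obtain ⟨l, hl⟩ : ∃ l, l = minProb p := ⟨_, rfl⟩
  have hl0 : 0 < l := by rw [hl, minProb]; exact lt_min hp0 (by linarith)
  have hl2 : l ≤ 1 / 2 := by
    rw [hl, minProb]
    rcases le_total p (1 / 2) with h | h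
    · exact (min_le_left _ _).trans h
    · exact (min_le_right _ _).trans (by linarith)
  have hl1 : 0 < 1 - l := by linarith
  have hhalf : l = 1 / 2 → p = 1 / 2 := fun h => by
    rw [hl, minProb] at h
    rcases min_choice p (1 - p) with h' | h' <;> linarith
  -- Swapping the two points exchanges `p` and `1 - p`, so the bias may be taken to be `λ ≤ 1/2`,
  -- which makes `h ≥ 0`.
  suffices H : TwoPoint l (1 + δ ^ 2) ((rhoOne ρ δ * δ) ^ 2) by
    rcases min_choice p (1 - p) with h | h
    · rwa [hl, minProb, h] at H
    · rw [hl, minProb, h] at H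
      simpa only [sub_sub_cancel] using H.symm
  obtain ⟨h, hh⟩ : ∃ h, h = -(log (l / (1 - l)) / 2) := ⟨_, rfl⟩
  have hexp : exp (-(2 * h)) = l / (1 - l) := by
    rw [hh, show -(2 * -(log (l / (1 - l)) / 2)) = log (l / (1 - l)) by ring,
      exp_log (by positivity)]
  have hlog : log (l / (1 - l)) = -(2 * h) := by rw [hh]; ring
  have hh0 : 0 ≤ h := by
    have : log (l / (1 - l)) ≤ 0 :=
      log_nonpos (by positivity) (by rw [div_le_one hl1]; linarith)
    linarith
  have hlh : l = exp (-h) / (2 * cosh h) := by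
    have e : exp (-h) = exp (-(2 * h)) * exp h := by rw [← exp_add]; ring_nf
    rw [cosh_eq, e, hexp]
    have := exp_pos h
    field_simp
    ring
  have hzero : h = 0 → l = 1 / 2 := fun h0 => by
    rw [hlh, h0]; simp
  rcases hδ0.eq_or_lt with rfl | hδ
  · exact twoPoint_of_sinh_le hs1 hs2 hh0 (by simp) (by simp) hlh
  obtain ⟨q, hq⟩ : ∃ q, q = 1 / δ ^ 2 + 1 := ⟨_, rfl⟩
  have hq2 : 2 ≤ q := by
    have : 1 ≤ 1 / δ ^ 2 := by rw [le_div_iff₀ (by positivity)]; nlinarith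
    linarith
  have hexple : exp (-(2 * h)) ≤ 1 := exp_le_one_iff.2 (by linarith)
  have hα0 : 0 ≤ 1 - 2 / q := by
    rw [sub_nonneg, div_le_one (by linarith)]; exact hq2
  have hα1 : 1 - 2 / q ≤ 1 := by
    have : 0 < 2 / q := by positivity
    linarith
  have hsinh : 0 ≤ sinh ((1 - 1 / q) * (2 * h)) := by
    refine sinh_nonneg_iff.2 (mul_nonneg ?_ (by linarith))
    have : 2 / q = 2 * (1 / q) := by ring
    have : 0 < 1 / q := by positivity
    linarith
  -- Any `ρ²` at most `(λ/(1-λ))^(1-2/q)` is admissible; this covers the power and ratio parameters.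
  have hsmall : ∀ t : ℝ, t ≤ exp (-(2 * h)) ^ (1 - 2 / q) →
      t * sinh ((1 - 1 / q) * (2 * h)) ≤ (q - 1) * sinh (1 / q * (2 * h)) ∧ (h = 0 → t ≤ 1) :=
    fun t ht => ⟨(mul_le_mul_of_nonneg_right ht hsinh).trans (exp_mul_sinh_le hq2 hh0),
      fun _ => ht.trans (rpow_le_one (exp_pos _).le hexple hα0)⟩
  have key : ρ q ^ 2 * sinh ((1 - 1 / q) * (2 * h)) ≤ (q - 1) * sinh (1 / q * (2 * h)) ∧
      (h = 0 → ρ q ^ 2 ≤ 1) := by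
    rcases hρ with rfl | rfl | rfl
    · refine hsmall _ ?_
      rw [rhoPower, ← hl, ← rpow_mul_natCast hl0.le,
        show (1 / 2 - 1 / q) * ((2 : ℕ) : ℝ) = 1 - 2 / q by push_cast; ring, hexp]
      refine rpow_le_rpow hl0.le ?_ hα0
      rw [le_div_iff₀ hl1]
      nlinarith
    · rw [rhoSinh]
      split_ifs with hp
      · have hl' : l = 1 / 2 := by rw [hl, minProb, hp]; norm_num
        have h0 : h = 0 := by rw [hh, hl']; norm_num
        simp [h0]
      · have h0 : 0 < h := hh0.lt_of_ne fun h0 => hp (hhalf (hzero h0.symm))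
        have hpos : 0 < sinh ((1 - 1 / q) * (2 * h)) := by
          refine sinh_pos_iff.2 (mul_pos ?_ (by linarith))
          have : 2 / q = 2 * (1 / q) := by ring
          have : 0 < 1 / q := by positivity
          linarith
        have hpos' : 0 < sinh (1 / q * (2 * h)) := sinh_pos_iff.2 (by positivity)
        refine ⟨le_of_eq ?_, fun h => absurd h h0.ne'⟩
        rw [← hl, hlog, neg_mul_neg, neg_mul_neg, mul_pow, sq_sqrt (by linarith),
          sq_sqrt (by positivity), mul_assoc, div_mul_cancel₀ _ hpos.ne']
    · refine hsmall _ ?_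
      rw [rhoRatio, ← hl, sq_sqrt (by positivity), ← hexp]
      exact (rpow_one _).symm.le.trans (rpow_le_rpow_of_exponent_ge (exp_pos _) hexple hα1)
  have hqδ : (q - 1) * δ ^ 2 = 1 := by rw [hq]; field_simp; ring
  have e1 : (1 - 1 / q) * (2 * h) = 2 * h / (1 + δ ^ 2) := by
    rw [hq]; field_simp; ring
  have e2 : 1 / q * (2 * h) = 2 * h - 2 * h / (1 + δ ^ 2) := by
    rw [← e1]; ring
  rw [e1, e2] at key
  refine twoPoint_of_sinh_le hs1 hs2 hh0 ?_ (fun h0 => ?_) hlh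
  · rw [rhoOne, ← hq]
    have := mul_le_mul_of_nonneg_right key.1 (sq_nonneg δ)
    linear_combination this + sinh (2 * h - 2 * h / (1 + δ ^ 2)) * hqδ
  · rw [rhoOne, ← hq, mul_pow]
    nlinarith [mul_le_mul_of_nonneg_right (key.2 h0) (sq_nonneg δ)]
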